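/- A \emph{positive $\Box$-algebra} is a pair $(L,\Box)$ where $L$ is a bounded distributive lattice (possibly with $0=1$) and $\Box:L\to L$ satisfies $\Box 1=1$ and $\Box a\wedge\Box b=\Box(a\wedge b)$ for all $a,b\in L$. Let $\mathsf{PMA}^\Box$ be the category of positive $\Box$-algebras and bounded lattice homomorphisms preserving $\Box$. A \emph{Priestley space} is a (possibly empty) compact topological space $X$ with a partial order $\le$ such that whenever $x\not\le y$ there is a clopen upset containing $x$ and missing $y$. A \emph{modal $\Box$-Priestley space} is a pair $(X,R)$ where $X$ is a Priestley space and $R$ is a binary relation on $X$ such that $R[x]=\{y\mid x\,R\,y\}$ is a closed upset for each $x\in X$, and $\Box_R U=\{x\in X\mid R[x]\subseteq U\}$ is a clopen upset for each clopen upset $U$ of $X$. A map $f:X\to X'$ between modal $\Box$-Priestley spaces $(X,R)$ and $(X',R')$ is a \emph{p-morphism} if (1) $f$ is order-preserving; (2) $x\,R\,z$ implies $f(x)\,R'\,f(z)$; (3) $f(x)\,R'\,y$ implies that there is $z\in X$ with $x\,R\,z$ and $f(z)\le y$. Let $\mathsf{MPS}^\Box$ be the category of modal $\Box$-Priestley spaces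 and continuous p-morphisms. \textbf{Theorem} (Goldblatt). The category $\mathsf{PMA}^\Box$ is dually equivalent to the category $\mathsf{MPS}^\Box$; that is, there is an equivalence of categories $(\mathsf{PMA}^\Box)^{\mathrm{op}}\simeq\mathsf{MPS}^\Box$. -/

import Mathlib

open CategoryTheory

universe u

/-- A positive `□`-algebra: a bounded distributive lattice with a unary operation `□` satisfying
`□ 1 = 1` and `□ a ∧ □ b = □ (a ∧ b)`. The one-element lattice is allowed. -/
structure PositiveBoxAlgebra : Type (u + 1) where
  carrier : Type u
  [lattice : DistribLattice carrier]
  [bounded : BoundedOrder carrier]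
  /-- The operation `□`. -/
  box : carrier → carrier
  box_top : box ⊤ = ⊤
  box_inf : ∀ a b : carrier, box a ⊓ box b = box (a ⊓ b)

namespace PositiveBoxAlgebra

attribute [instance] PositiveBoxAlgebra.lattice PositiveBoxAlgebra.bounded

/-- Morphisms of positive `□`-algebras: bounded lattice homomorphisms preserving `□`. -/
@[ext]
structure Hom (L M : PositiveBoxAlgebra.{u}) : Type u where
  toBoundedLatticeHom : BoundedLatticeHom L.carrier M.carrier
  map_box : ∀ a : L.carrier, toBoundedLatticeHom (L.box a) = M.box (toBoundedLatticeHom a)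

/-- The category of positive `□`-algebras. -/
instance : Category.{u} PositiveBoxAlgebra.{u} where
  Hom L M := Hom L M
  id L := ⟨BoundedLatticeHom.id L.carrier, fun _ => rfl⟩
  comp f g := ⟨g.toBoundedLatticeHom.comp f.toBoundedLatticeHom, fun a => by
    simp only [BoundedLatticeHom.comp_apply, f.map_box, g.map_box]⟩

end PositiveBoxAlgebra

/-- For a binary relation `R` on `X`, the set `□_R U = {x | R[x] ⊆ U}`,
where `R[x] = {y | x R y}`. -/
def relBox {X : Type u} (R : X → X → Prop) (U : Set X) : Set X :=
  {x | {y | R x y} ⊆ U}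

/-- A modal `□`-Priestley space: a Priestley space (compact, partially ordered, satisfying the
Priestley separation axiom) with a binary relation `R` such that each `R[x]` is a closed upset and
`□_R U` is a clopen upset for every clopen upset `U`. The empty space is allowed. -/
structure ModalBoxPriestleySpace : Type (u + 1) where
  carrier : Type u
  [topology : TopologicalSpace carrier]
  [order : PartialOrder carrier]
  [compact : CompactSpace carrier]
  [priestley : PriestleySpace carrier]
  /-- The accessibility relation. -/
  R : carrier → carrier → Prop
  isClosed_image : ∀ x : carrier, IsClosed {y | R x y}
  isUpperSet_image : ∀ x : carrier, IsUpperSet {y | R x y}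
  isClopen_relBox : ∀ U : Set carrier, IsClopen U → IsUpperSet U → IsClopen (relBox R U)
  isUpperSet_relBox : ∀ U : Set carrier, IsClopen U → IsUpperSet U → IsUpperSet (relBox R U)

namespace ModalBoxPriestleySpace

attribute [instance] ModalBoxPriestleySpace.topology ModalBoxPriestleySpace.order
  ModalBoxPriestleySpace.compact ModalBoxPriestleySpace.priestley

/-- Morphisms of modal `□`-Priestley spaces: continuous p-morphisms, that is, continuous
order-preserving maps satisfying the forth and back conditions. -/
@[ext]
structure Hom (X Y : ModalBoxPriestleySpace.{u}) : Type u where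
  toContinuousOrderHom : X.carrier →Co Y.carrier
  forth : ∀ x z : X.carrier, X.R x z → Y.R (toContinuousOrderHom x) (toContinuousOrderHom z)
  back : ∀ (x : X.carrier) (y : Y.carrier), Y.R (toContinuousOrderHom x) y →
    ∃ z : X.carrier, X.R x z ∧ toContinuousOrderHom z ≤ y

/-- The category of modal `□`-Priestley spaces and continuous p-morphisms. -/
instance : Category.{u} ModalBoxPriestleySpace.{u} where
  Hom X Y := Hom X Y
  id X := ⟨ContinuousOrderHom.id X.carrier, fun _ _ h => h, fun _ y h => ⟨y, h, le_refl y⟩⟩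
  comp f g := ⟨g.toContinuousOrderHom.comp f.toContinuousOrderHom,
    fun x z h => g.forth _ _ (f.forth x z h),
    fun x y h => by
      obtain ⟨w, hw, hwy⟩ := g.back _ y h
      obtain ⟨z, hz, hzw⟩ := f.back x w hw
      exact ⟨z, hz, le_trans (g.toContinuousOrderHom.monotone' hzw) hwy⟩⟩

end ModalBoxPriestleySpace

/-!
Sending a modal `□`-Priestley space `X` to the lattice of its clopen upsets, with `□_R` as the
operation `□`, and a p-morphism to its preimage map, is a contravariant functor. It is an
equivalence because it is faithful, full and essentially surjective.

Most uses of compactness go through `IsCompact.exists_separating_mem`: if a family of clopen sets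
is closed under finite unions and intersections and separates each point of a compact set `C` from
each point of a compact set `D`, then one member of the family contains `C` and misses `D`.

* *Faithful*: clopen upsets separate the points of a Priestley space.
* *Full*: every prime filter of clopen upsets consists of the clopen upsets containing some point
  (`PrimeFilter.exists_point`). So a homomorphism `h` from the clopen upsets of `Y` to those of `X`
  has the form `U ↦ f ⁻¹' U` for a function `f : X → Y`. Separating `R[f x]` from the point `f z`
  gives the forth condition for `f`, and separating `f '' R[x]` from the point `y` gives the back
  condition, in both cases because `h` preserves `□`.
* *Essentially surjective*: on the space of prime filters of `L`, ordered by inclusion, put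
  `x R y` when `□ a ∈ x` implies `a ∈ y`. The prime filter theorem shows that `□_R` sends the basic
  set of prime filters containing `a` to the one for `□ a`, and that `L` embeds into the clopen
  upsets; by compactness every clopen upset is basic.
-/

open TopologicalSpace Set

/-! ### Separation of compact sets by clopen sets -/

theorem IsCompact.exists_separating_mem {X : Type*} [TopologicalSpace X] {B : Set (Set X)}
    (hclopen : ∀ U ∈ B, IsClopen U) (hempty : ∅ ∈ B) (huniv : univ ∈ B)
    (hunion : ∀ U ∈ B, ∀ V ∈ B, U ∪ V ∈ B) (hinter : ∀ U ∈ B, ∀ V ∈ B, U ∩ V ∈ B)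
    {C D : Set X} (hC : IsCompact C) (hD : IsCompact D)
    (hsep : ∀ x ∈ C, ∀ y ∈ D, ∃ U ∈ B, x ∈ U ∧ y ∉ U) :
    ∃ U ∈ B, C ⊆ U ∧ ∀ y ∈ D, y ∉ U := by
  have hpoint : ∀ x ∈ C, ∃ U ∈ B, x ∈ U ∧ ∀ y ∈ D, y ∉ U := by
    intro x hx
    refine hD.induction_on (p := fun s => ∃ U ∈ B, x ∈ U ∧ ∀ y ∈ s, y ∉ U) ?_ ?_ ?_ ?_
    · exact ⟨univ, huniv, mem_univ x, fun y hy => hy.elim⟩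
    · rintro s t hst ⟨U, hU, hxU, h⟩
      exact ⟨U, hU, hxU, fun y hy => h y (hst hy)⟩
    · rintro s t ⟨U, hU, hxU, hs⟩ ⟨V, hV, hxV, ht⟩
      refine ⟨U ∩ V, hinter U hU V hV, ⟨hxU, hxV⟩, ?_⟩
      rintro y (hy | hy) ⟨hyU, hyV⟩
      exacts [hs y hy hyU, ht y hy hyV]
    · intro y hy
      obtain ⟨U, hU, hxU, hyU⟩ := hsep x hx y hy
      exact ⟨Uᶜ, mem_nhdsWithin_of_mem_nhds ((hclopen U hU).compl.isOpen.mem_nhds hyU),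
        U, hU, hxU, fun z hz => hz⟩
  refine hC.induction_on (p := fun s => ∃ U ∈ B, s ⊆ U ∧ ∀ y ∈ D, y ∉ U) ?_ ?_ ?_ ?_
  · exact ⟨∅, hempty, Subset.rfl, fun y _ hy => hy⟩
  · rintro s t hst ⟨U, hU, htU, h⟩
    exact ⟨U, hU, hst.trans htU, h⟩
  · rintro s t ⟨U, hU, hsU, hUD⟩ ⟨V, hV, htV, hVD⟩
    refine ⟨U ∪ V, hunion U hU V hV, union_subset_union hsU htV, ?_⟩
    rintro y hy (hyU | hyV)
    exacts [hUD y hy hyU, hVD y hy hyV]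
  · intro x hx
    obtain ⟨U, hU, hxU, h⟩ := hpoint x hx
    exact ⟨U, mem_nhdsWithin_of_mem_nhds ((hclopen U hU).isOpen.mem_nhds hxU), U, hU,
      Subset.rfl, h⟩

/-- `IsCompact.exists_separating_mem` for the family of clopen upsets of a Priestley space. -/
theorem IsCompact.exists_clopenUpperSet_separating {X : Type*} [TopologicalSpace X] [PartialOrder X]
    [PriestleySpace X] {C D : Set X} (hC : IsCompact C) (hD : IsCompact D)
    (hsep : ∀ x ∈ C, ∀ y ∈ D, ¬ x ≤ y) :
    ∃ U : ClopenUpperSet X, C ⊆ U ∧ ∀ y ∈ D, y ∉ U := by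
  obtain ⟨U, ⟨hU, hU'⟩, h⟩ := IsCompact.exists_separating_mem
    (B := {U : Set X | IsClopen U ∧ IsUpperSet U}) (fun U hU => hU.1)
    ⟨isClopen_empty, isUpperSet_empty⟩ ⟨isClopen_univ, isUpperSet_univ⟩
    (fun U hU V hV => ⟨hU.1.union hV.1, hU.2.union hV.2⟩)
    (fun U hU V hV => ⟨hU.1.inter hV.1, hU.2.inter hV.2⟩) hC hD
    (fun x hx y hy => by
      obtain ⟨U, hU, hU', hxU, hyU⟩ := exists_isClopen_upper_of_not_le (hsep x hx y hy)
      exact ⟨U, ⟨hU, hU'⟩, hxU, hyU⟩)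
  exact ⟨⟨⟨U, hU⟩, hU'⟩, h⟩

namespace ClopenUpperSet

instance {X : Type*} [TopologicalSpace X] [LE X] : DistribLattice (ClopenUpperSet X) where
  le_sup_inf U V W := by
    rintro x ⟨hV | hV, hW | hW⟩
    exacts [Or.inl hV, Or.inl hV, Or.inl hW, Or.inr ⟨hV, hW⟩]

theorem le_of_forall_mem {X : Type*} [TopologicalSpace X] [PartialOrder X] [PriestleySpace X]
    {x y : X} (h : ∀ U : ClopenUpperSet X, x ∈ U → y ∈ U) : x ≤ y := by
  by_contra hxy
  obtain ⟨U, hU, hU', hxU, hyU⟩ := exists_isClopen_upper_of_not_le hxy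
  exact hyU (h ⟨⟨U, hU⟩, hU'⟩ hxU)

theorem eq_of_forall_mem_iff {X : Type*} [TopologicalSpace X] [PartialOrder X] [PriestleySpace X]
    {x y : X} (h : ∀ U : ClopenUpperSet X, x ∈ U ↔ y ∈ U) : x = y :=
  le_antisymm (le_of_forall_mem fun U => (h U).1) (le_of_forall_mem fun U => (h U).2)

end ClopenUpperSet

/-! ### Prime filters of a bounded lattice -/

/-- A prime filter of a bounded lattice: a set of elements whose indicator is a bounded lattice
homomorphism to `Prop`. In particular it is proper, since it misses `⊥`. -/
@[ext]
structure PrimeFilter (L : Type*) [Lattice L] [BoundedOrder L] where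
  carrier : Set L
  top_mem : ⊤ ∈ carrier
  bot_notMem : ⊥ ∉ carrier
  inf_mem_iff : ∀ a b, a ⊓ b ∈ carrier ↔ a ∈ carrier ∧ b ∈ carrier
  sup_mem_iff : ∀ a b, a ⊔ b ∈ carrier ↔ a ∈ carrier ∨ b ∈ carrier

namespace PrimeFilter

section Lattice

variable {L : Type*} [Lattice L] [BoundedOrder L]

/-- Prime filters are ordered by inclusion. -/
instance : PartialOrder (PrimeFilter L) :=
  PartialOrder.lift carrier fun _ _ => PrimeFilter.ext

theorem mem_of_le (x : PrimeFilter L) {a b : L} (hab : a ≤ b) (ha : a ∈ x.carrier) :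
    b ∈ x.carrier := by
  have h := (x.inf_mem_iff a b).1
  rw [inf_eq_left.2 hab] at h
  exact (h ha).2

/-- The set of prime filters containing `a`. -/
def basic (a : L) : Set (PrimeFilter L) := {x | a ∈ x.carrier}

/-- The patch topology: the coarsest one in which every `basic a` is clopen. -/
instance : TopologicalSpace (PrimeFilter L) :=
  generateFrom {U | ∃ a : L, U = basic a ∨ U = (basic a)ᶜ}

theorem isClopen_basic (a : L) : IsClopen (basic a) :=
  ⟨⟨isOpen_generateFrom_of_mem ⟨a, Or.inr rfl⟩⟩, isOpen_generateFrom_of_mem ⟨a, Or.inl rfl⟩⟩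

theorem isUpperSet_basic (a : L) : IsUpperSet (basic a) := fun _ _ hxy ha => hxy ha

theorem exists_basic_of_not_le {x y : PrimeFilter L} (h : ¬ x ≤ y) :
    ∃ a, x ∈ basic a ∧ y ∉ basic a :=
  not_subset.1 h

instance : PriestleySpace (PrimeFilter L) where
  priestley h := by
    obtain ⟨a, hx, hy⟩ := exists_basic_of_not_le h
    exact ⟨basic a, isClopen_basic a, isUpperSet_basic a, hx, hy⟩

/-- An ultrafilter `F` of prime filters converges to the prime filter of those `a` that belong to
`F`-almost every prime filter. -/
instance : CompactSpace (PrimeFilter L) where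
  isCompact_univ := by
    rw [isCompact_iff_ultrafilter_le_nhds]
    intro F _
    let p : PrimeFilter L :=
      { carrier := {a | ∀ᶠ x : PrimeFilter L in F, a ∈ x.carrier}
        top_mem := Filter.Eventually.of_forall fun x => x.top_mem
        bot_notMem := fun h => by
          obtain ⟨x, hx⟩ := Filter.Eventually.exists h
          exact x.bot_notMem hx
        inf_mem_iff := fun a b => by
          simp only [mem_ofPred_eq, PrimeFilter.inf_mem_iff]
          exact Filter.eventually_and
        sup_mem_iff := fun a b => by
          simp only [mem_ofPred_eq, PrimeFilter.sup_mem_iff]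
          exact Ultrafilter.eventually_or }
    refine ⟨p, mem_univ p, ?_⟩
    rw [nhds_generateFrom]
    refine le_iInf₂ fun U hU => ?_
    obtain ⟨hpU, a, rfl | rfl⟩ := hU
    · exact Filter.le_principal_iff.2 hpU
    · exact Filter.le_principal_iff.2 (Ultrafilter.compl_mem_iff_notMem.2 hpU)

/-- Every clopen upset of prime filters is basic. -/
theorem exists_eq_basic {U : Set (PrimeFilter L)} (hU : IsClopen U) (hU' : IsUpperSet U) :
    ∃ a, U = basic a := by
  obtain ⟨_, ⟨a, rfl⟩, hUa, haU⟩ := IsCompact.exists_separating_mem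
    (B := range (basic (L := L))) (C := U) (D := Uᶜ)
    (by rintro _ ⟨a, rfl⟩; exact isClopen_basic a)
    ⟨⊥, eq_empty_of_forall_notMem fun x => x.bot_notMem⟩
    ⟨⊤, eq_univ_of_forall fun x => x.top_mem⟩
    (by rintro _ ⟨a, rfl⟩ _ ⟨b, rfl⟩; exact ⟨a ⊔ b, ext fun x => x.sup_mem_iff a b⟩)
    (by rintro _ ⟨a, rfl⟩ _ ⟨b, rfl⟩; exact ⟨a ⊓ b, ext fun x => x.inf_mem_iff a b⟩)
    hU.isClosed.isCompact hU.compl.isClosed.isCompact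
    (fun x hx y hy => by
      obtain ⟨a, ha⟩ := exists_basic_of_not_le fun hxy => hy (hU' hxy hx)
      exact ⟨basic a, ⟨a, rfl⟩, ha⟩)
  exact ⟨a, hUa.antisymm fun x hx => by_contra fun hxU => haU x hxU hx⟩

/-- The preimage of a prime filter under a bounded lattice homomorphism. -/
def comap {M : Type*} [Lattice M] [BoundedOrder M] (h : BoundedLatticeHom L M)
    (x : PrimeFilter M) : PrimeFilter L where
  carrier := h ⁻¹' x.carrier
  top_mem := by simpa using x.top_mem
  bot_notMem := by simpa using x.bot_notMem
  inf_mem_iff a b := by simp [x.inf_mem_iff]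
  sup_mem_iff a b := by simp [x.sup_mem_iff]

end Lattice

/-- The prime filter theorem, for a filter and an element outside it. -/
theorem exists_of_notMem {L : Type*} [DistribLattice L] [BoundedOrder L] {F : Set L}
    (htop : ⊤ ∈ F) (hinf : ∀ a ∈ F, ∀ b ∈ F, a ⊓ b ∈ F) (hup : ∀ a b, a ≤ b → a ∈ F → b ∈ F)
    {a : L} (ha : a ∉ F) : ∃ x : PrimeFilter L, F ⊆ x.carrier ∧ a ∉ x.carrier := by
  have hF : Order.IsPFilter F := .of_def ⟨⊤, htop⟩
    (fun b hb c hc => ⟨b ⊓ c, hinf b hb c hc, inf_le_left, inf_le_right⟩) (hup _ _)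
  obtain ⟨J, hJ, haJ, hFJ⟩ := DistribLattice.prime_ideal_of_disjoint_filter_ideal
    (F := hF.toPFilter) (I := Order.Ideal.principal a)
    (disjoint_left.2 fun b hb hba => ha (hup b a hba hb))
  have hFJ' : ∀ b ∈ F, b ∉ J := fun b hb hbJ => disjoint_left.1 hFJ hb hbJ
  refine ⟨⟨{b | b ∉ J}, hFJ' ⊤ htop, fun h => h J.bot_mem, fun b c => ?_, fun b c => ?_⟩, hFJ',
    fun h => h (Order.Ideal.principal_le_iff.1 haJ)⟩
  · refine ⟨fun h => ⟨fun hb => h (J.lower inf_le_left hb), fun hc => h (J.lower inf_le_right hc)⟩,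
      fun h hbc => ?_⟩
    exact (hJ.mem_or_mem hbc).elim h.1 h.2
  · change ¬ (b ⊔ c ∈ J) ↔ ¬ (b ∈ J) ∨ ¬ (c ∈ J)
    rw [Order.Ideal.sup_mem_iff, not_and_or]

/-- The prime filter of the clopen upsets containing a given point. -/
def ofPoint {X : Type*} [TopologicalSpace X] [LE X] (x : X) :
    PrimeFilter (ClopenUpperSet X) where
  carrier := {U | x ∈ U}
  top_mem := mem_univ x
  bot_notMem := fun h => h
  inf_mem_iff _ _ := Iff.rfl
  sup_mem_iff _ _ := Iff.rfl

/-- In a compact space the prime filters of clopen upsets are given by points: the differences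
`U \ V` with `U` in the prime filter and `V` outside it form a directed family of nonempty closed
sets. -/
theorem exists_point {X : Type*} [TopologicalSpace X] [LE X] [CompactSpace X]
    (P : PrimeFilter (ClopenUpperSet X)) :
    ∃ x : X, ∀ U : ClopenUpperSet X, x ∈ U ↔ U ∈ P.carrier := by
  let ι := {p : ClopenUpperSet X × ClopenUpperSet X // p.1 ∈ P.carrier ∧ p.2 ∉ P.carrier}
  let t : ι → Set X := fun p => (p.1.1 : Set X) \ p.1.2
  have : Nonempty ι := ⟨⟨(⊤, ⊥), P.top_mem, P.bot_notMem⟩⟩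
  have ht : ∀ i, IsClosed (t i) := fun i => (i.1.1.isClopen.diff i.1.2.isClopen).isClosed
  obtain ⟨x, hx⟩ := IsCompact.nonempty_iInter_of_directed_nonempty_isCompact_isClosed t
    (by
      rintro ⟨⟨U, V⟩, hU, hV⟩ ⟨⟨U', V'⟩, hU', hV'⟩
      refine ⟨⟨(U ⊓ U', V ⊔ V'), (P.inf_mem_iff _ _).2 ⟨hU, hU'⟩,
        fun h => ((P.sup_mem_iff _ _).1 h).elim hV hV'⟩, ?_, ?_⟩
      · exact fun x hx => ⟨hx.1.1, fun h => hx.2 (Or.inl h)⟩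
      · exact fun x hx => ⟨hx.1.2, fun h => hx.2 (Or.inr h)⟩)
    (by
      rintro ⟨⟨U, V⟩, hU, hV⟩
      by_contra h
      exact hV (P.mem_of_le (sdiff_eq_empty.1 (not_nonempty_iff_eq_empty.1 h)) hU))
    (fun i => (ht i).isCompact) ht
  rw [mem_iInter] at hx
  refine ⟨x, fun U => ⟨fun hU => by_contra fun hUP => ?_, fun hU => ?_⟩⟩
  · exact (hx ⟨(⊤, U), P.top_mem, hUP⟩).2 hU
  · exact (hx ⟨(U, ⊥), hU, P.bot_notMem⟩).1

end PrimeFilter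

/-! ### The functor of clopen upsets -/

namespace ModalBoxPriestleySpace

/-- The positive `□`-algebra of clopen upsets of a modal `□`-Priestley space. -/
abbrev clopenUpsets (X : ModalBoxPriestleySpace.{u}) : PositiveBoxAlgebra.{u} where
  carrier := ClopenUpperSet X.carrier
  box U := ⟨⟨relBox X.R U, X.isClopen_relBox U U.isClopen U.upper⟩,
    X.isUpperSet_relBox U U.isClopen U.upper⟩
  box_top := ClopenUpperSet.ext (eq_univ_of_forall fun _ => subset_univ _)
  box_inf _ _ := ClopenUpperSet.ext (ext fun _ => subset_inter_iff.symm)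

theorem mem_box_clopenUpsets {X : ModalBoxPriestleySpace.{u}} {x : X.carrier}
    {U : ClopenUpperSet X.carrier} :
    x ∈ ((clopenUpsets X).box U : ClopenUpperSet X.carrier) ↔ ∀ y, X.R x y → y ∈ U :=
  Iff.rfl

/-- Preimages of clopen upsets under a continuous p-morphism. -/
def clopenUpsetsMap {X Y : ModalBoxPriestleySpace.{u}} (f : Hom X Y) :
    PositiveBoxAlgebra.Hom (clopenUpsets Y) (clopenUpsets X) where
  toBoundedLatticeHom :=
    { toFun := fun U : ClopenUpperSet Y.carrier =>
        (⟨⟨f.toContinuousOrderHom ⁻¹' U,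
            U.isClopen.preimage f.toContinuousOrderHom.continuous_toFun⟩,
          U.upper.preimage f.toContinuousOrderHom.monotone'⟩ : ClopenUpperSet X.carrier)
      map_sup' := fun _ _ => rfl
      map_inf' := fun _ _ => rfl
      map_top' := rfl
      map_bot' := rfl }
  map_box U := by
    refine ClopenUpperSet.ext (ext fun x => ⟨fun h z hz => h (f.forth x z hz), fun h y hy => ?_⟩)
    obtain ⟨z, hz, hzy⟩ := f.back x y hy
    exact U.upper hzy (h hz)

theorem mem_clopenUpsetsMap {X Y : ModalBoxPriestleySpace.{u}} (f : Hom X Y)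
    (U : ClopenUpperSet Y.carrier) (x : X.carrier) :
    x ∈ ((clopenUpsetsMap f).toBoundedLatticeHom U : ClopenUpperSet X.carrier) ↔
      f.toContinuousOrderHom x ∈ U :=
  Iff.rfl

theorem clopenUpsetsMap_injective {X Y : ModalBoxPriestleySpace.{u}} :
    Function.Injective (clopenUpsetsMap (X := X) (Y := Y)) := by
  intro f g h
  refine Hom.ext (ContinuousOrderHom.ext fun x => ClopenUpperSet.eq_of_forall_mem_iff fun U => ?_)
  rw [← mem_clopenUpsetsMap, ← mem_clopenUpsetsMap, h]

/-- The contravariant functor of clopen upsets. -/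
def clopenUpsetsFunctor : ModalBoxPriestleySpace.{u}ᵒᵖ ⥤ PositiveBoxAlgebra.{u} where
  obj X := clopenUpsets X.unop
  map f := clopenUpsetsMap f.unop

instance : clopenUpsetsFunctor.{u}.Faithful where
  map_injective h := Quiver.Hom.unop_inj (clopenUpsetsMap_injective h)

/-- A function into a compact Priestley space is continuous if the preimages of clopen upsets are
clopen, because clopen upsets and their complements separate points. -/
theorem continuous_of_isClopen_preimage {X Y : Type*} [TopologicalSpace X] [TopologicalSpace Y]
    [PartialOrder Y] [CompactSpace Y] [PriestleySpace Y] {f : X → Y}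
    (hf : ∀ U : ClopenUpperSet Y, IsClopen (f ⁻¹' U)) : Continuous f := by
  refine continuous_iff_continuousAt.2 fun x => ?_
  rw [ContinuousAt, (nhds_basis_opens (f x)).tendsto_right_iff]
  rintro W ⟨hxW, hW⟩
  obtain ⟨V, ⟨hV, hfV⟩, hxV, hVW⟩ := IsCompact.exists_separating_mem
    (B := {V : Set Y | IsClopen V ∧ IsClopen (f ⁻¹' V)}) (C := {f x}) (D := Wᶜ)
    (fun V hV => hV.1) ⟨isClopen_empty, isClopen_empty⟩ ⟨isClopen_univ, isClopen_univ⟩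
    (fun U hU V hV => ⟨hU.1.union hV.1, hU.2.union hV.2⟩)
    (fun U hU V hV => ⟨hU.1.inter hV.1, hU.2.inter hV.2⟩)
    isCompact_singleton hW.isClosed_compl.isCompact
    (by
      rintro _ rfl y hy
      have hne : f x ≠ y := fun h => hy (h ▸ hxW)
      obtain ⟨V, hV, hV' | hV', hxV, hyV⟩ := exists_isClopen_upper_or_lower_of_ne hne
      · exact ⟨V, ⟨hV, hf ⟨⟨V, hV⟩, hV'⟩⟩, hxV, hyV⟩
      · have h := hf ⟨⟨Vᶜ, hV.compl⟩, hV'.compl⟩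
        exact ⟨V, ⟨hV, isClopen_compl_iff.1 h⟩, hxV, hyV⟩)
  filter_upwards [hfV.isOpen.mem_nhds (hxV rfl)] with z hz
  exact by_contra fun hzW => hVW (f z) hzW hz

/-- Every homomorphism between algebras of clopen upsets is the preimage map of a morphism. -/
theorem clopenUpsetsMap_surjective {X Y : ModalBoxPriestleySpace.{u}} :
    Function.Surjective (clopenUpsetsMap (X := X) (Y := Y)) := by
  intro h
  choose f hf using fun x : X.carrier =>
    (PrimeFilter.comap h.toBoundedLatticeHom (PrimeFilter.ofPoint x)).exists_point
  replace hf : ∀ (x : X.carrier) (U : ClopenUpperSet Y.carrier),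
      f x ∈ U ↔ x ∈ (h.toBoundedLatticeHom U : ClopenUpperSet X.carrier) := hf
  -- The equation `h (□ U) = □ (h U)`, read at the point `x`; both modal conditions follow from it.
  have hbox : ∀ (x : X.carrier) (U : ClopenUpperSet Y.carrier),
      (∀ y, Y.R (f x) y → y ∈ U) ↔ ∀ z, X.R x z → f z ∈ U := by
    intro x U
    have := hf x ((clopenUpsets Y).box U)
    rw [h.map_box, mem_box_clopenUpsets, mem_box_clopenUpsets] at this
    simpa only [hf] using this
  have hmono : Monotone f := fun x x' hxx' => ClopenUpperSet.le_of_forall_mem fun U hU =>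
    (hf x' U).2 ((h.toBoundedLatticeHom U).upper hxx' ((hf x U).1 hU))
  have hcont : Continuous f := continuous_of_isClopen_preimage fun U => by
    have : f ⁻¹' U = ((h.toBoundedLatticeHom U : ClopenUpperSet X.carrier) : Set X.carrier) :=
      ext fun x => hf x U
    rw [this]
    exact ClopenUpperSet.isClopen _
  refine ⟨⟨⟨⟨f, hmono⟩, hcont⟩, fun x z hxz => ?_, fun x y hxy => ?_⟩,
    PositiveBoxAlgebra.Hom.ext (BoundedLatticeHom.ext fun U =>
      ClopenUpperSet.ext (ext fun x => hf x U))⟩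
  · change Y.R (f x) (f z)
    by_contra hR
    obtain ⟨U, hU, hzU⟩ := IsCompact.exists_clopenUpperSet_separating
      (C := {y | Y.R (f x) y}) (D := {f z}) (Y.isClosed_image (f x)).isCompact isCompact_singleton
      (by rintro y hy _ rfl hle; exact hR (Y.isUpperSet_image (f x) hle hy))
    exact hzU (f z) rfl ((hbox x U).1 (fun y hy => hU hy) z hxz)
  · change ∃ z, X.R x z ∧ f z ≤ y
    by_contra! hback
    obtain ⟨U, hU, hyU⟩ := IsCompact.exists_clopenUpperSet_separating
      (C := f '' {z | X.R x z}) (D := {y}) ((X.isClosed_image x).isCompact.image hcont)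
      isCompact_singleton
      (by rintro _ ⟨z, hz, rfl⟩ _ rfl; exact hback z hz)
    exact hyU y rfl ((hbox x U).2 (fun z hz => hU (mem_image_of_mem f hz)) y hxy)

instance : clopenUpsetsFunctor.{u}.Full where
  map_surjective h := (clopenUpsetsMap_surjective h).imp' Quiver.Hom.op fun _ hf => hf

end ModalBoxPriestleySpace

/-! ### The space of prime filters of a positive `□`-algebra -/

namespace PositiveBoxAlgebra

open PrimeFilter

theorem box_mono (L : PositiveBoxAlgebra.{u}) {a b : L.carrier} (hab : a ≤ b) :
    L.box a ≤ L.box b := by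
  rw [← inf_eq_left, L.box_inf, inf_eq_left.2 hab]

/-- The canonical relation between prime filters of a positive `□`-algebra. -/
def canonicalRel (L : PositiveBoxAlgebra.{u}) (x y : PrimeFilter L.carrier) : Prop :=
  ∀ a, L.box a ∈ x.carrier → a ∈ y.carrier

theorem relBox_basic (L : PositiveBoxAlgebra.{u}) (a : L.carrier) :
    relBox L.canonicalRel (basic a) = basic (L.box a) := by
  ext x
  refine ⟨fun h => ?_, fun h y hy => hy a h⟩
  -- If `□ a ∉ x`, a prime filter extending `{b | □ b ∈ x}` and missing `a` is a successor of `x`.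
  by_contra ha
  obtain ⟨y, hy, hay⟩ := exists_of_notMem (F := {b | L.box b ∈ x.carrier}) (a := a)
    (by
      change L.box ⊤ ∈ x.carrier
      rw [L.box_top]
      exact x.top_mem)
    (fun b hb c hc => by
      change L.box (b ⊓ c) ∈ x.carrier
      rw [← L.box_inf]
      exact (x.inf_mem_iff _ _).2 ⟨hb, hc⟩)
    (fun b c hbc hb => x.mem_of_le (L.box_mono hbc) hb) ha
  exact hay (h hy)

/-- The modal `□`-Priestley space of prime filters of a positive `□`-algebra. -/
abbrev primeFilterSpace (L : PositiveBoxAlgebra.{u}) : ModalBoxPriestleySpace.{u} where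
  carrier := PrimeFilter L.carrier
  R := L.canonicalRel
  isClosed_image x := by
    have : {y | L.canonicalRel x y} = ⋂ (a) (_ : L.box a ∈ x.carrier), basic a := by
      ext y
      simp only [mem_iInter]
      rfl
    rw [this]
    exact isClosed_biInter fun a _ => (isClopen_basic a).isClosed
  isUpperSet_image _ y z hyz hy a ha := (show y.carrier ⊆ z.carrier from hyz) (hy a ha)
  isClopen_relBox U hU hU' := by
    obtain ⟨a, rfl⟩ := exists_eq_basic hU hU'
    rw [relBox_basic]
    exact isClopen_basic _
  isUpperSet_relBox U hU hU' := by
    obtain ⟨a, rfl⟩ := exists_eq_basic hU hU'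
    rw [relBox_basic]
    exact isUpperSet_basic _

/-- The homomorphism from a positive `□`-algebra to the clopen upsets of its space of prime filters,
sending `a` to the set of prime filters containing `a`. -/
def basicHom (L : PositiveBoxAlgebra.{u}) : Hom L L.primeFilterSpace.clopenUpsets where
  toBoundedLatticeHom :=
    { toFun := fun a =>
        (⟨⟨basic a, isClopen_basic a⟩, isUpperSet_basic a⟩ : ClopenUpperSet (PrimeFilter L.carrier))
      map_sup' := fun a b => ClopenUpperSet.ext (ext fun x => x.sup_mem_iff a b)
      map_inf' := fun a b => ClopenUpperSet.ext (ext fun x => x.inf_mem_iff a b)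
      map_top' := ClopenUpperSet.ext (eq_univ_of_forall fun x => x.top_mem)
      map_bot' := ClopenUpperSet.ext (eq_empty_of_forall_notMem fun x => x.bot_notMem) }
  map_box a := ClopenUpperSet.ext (L.relBox_basic a).symm

/-- Injectivity is the prime filter theorem for principal filters. -/
theorem basicHom_bijective (L : PositiveBoxAlgebra.{u}) :
    Function.Bijective L.basicHom.toBoundedLatticeHom := by
  have hle : ∀ a b : L.carrier, basic a ⊆ basic b → a ≤ b := by
    intro a b hab
    by_contra h
    obtain ⟨x, hx, hbx⟩ := exists_of_notMem (F := Ici a) (a := b) le_top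
      (fun _ hc _ hd => le_inf hc hd) (fun _ _ hcd hc => le_trans hc hcd) h
    exact hbx (hab (hx self_mem_Ici))
  refine ⟨fun a b hab => ?_, fun U => ?_⟩
  · have hab' : basic a = basic b := congrArg SetLike.coe hab
    exact le_antisymm (hle a b hab'.subset) (hle b a hab'.superset)
  · obtain ⟨a, ha⟩ := exists_eq_basic U.isClopen U.upper
    exact ⟨a, ClopenUpperSet.ext ha.symm⟩

theorem isIso_of_bijective {L M : PositiveBoxAlgebra.{u}} (h : L ⟶ M)
    (hh : Function.Bijective (Hom.toBoundedLatticeHom h)) : IsIso h := by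
  let e := Equiv.ofBijective _ hh
  have he : ∀ b, Hom.toBoundedLatticeHom h (e.symm b) = b := e.apply_symm_apply
  let g : M ⟶ L :=
    { toBoundedLatticeHom :=
        { toFun := e.symm
          map_sup' := fun a b => hh.1 (by rw [he, map_sup h.toBoundedLatticeHom, he, he])
          map_inf' := fun a b => hh.1 (by rw [he, map_inf h.toBoundedLatticeHom, he, he])
          map_top' := hh.1 (by rw [he, map_top h.toBoundedLatticeHom])
          map_bot' := hh.1 (by rw [he, map_bot h.toBoundedLatticeHom]) }
      map_box := fun a => hh.1 (by
        rw [Hom.map_box]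
        exact (he _).trans (congrArg M.box (he a).symm)) }
  exact ⟨g, Hom.ext (BoundedLatticeHom.ext e.symm_apply_apply), Hom.ext (BoundedLatticeHom.ext he)⟩

instance : ModalBoxPriestleySpace.clopenUpsetsFunctor.{u}.EssSurj where
  mem_essImage L :=
    have : IsIso (C := PositiveBoxAlgebra.{u}) L.basicHom :=
      isIso_of_bijective _ L.basicHom_bijective
    ⟨Opposite.op L.primeFilterSpace, ⟨(asIso (C := PositiveBoxAlgebra.{u}) L.basicHom).symm⟩⟩

end PositiveBoxAlgebra

theorem mainTheorem10 :
    Nonempty (PositiveBoxAlgebra.{u}ᵒᵖ ≌ ModalBoxPriestleySpace.{u}) := by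
  have : ModalBoxPriestleySpace.clopenUpsetsFunctor.{u}.IsEquivalence := {}
  exact ⟨ModalBoxPriestleySpace.clopenUpsetsFunctor.rightOp.asEquivalence.symm⟩
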